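/- Let $A_0,A_1\in\mathbb R^{n\times n}$, $B\in\mathbb R^{n\times m}$ and let $\bar h\ge 1$ be an integer. Consider the delay system $$x(k+1)=A_0x(k)+A_1x(k-h_1(k))+Bu(k-h_2(k)),\qquad k\ge 0 .\tag{1}$$ **Data.** For some $T>\bar h$, sequences $x=x^{\rm nom}+x^\delta$ and $u=u^{\rm nom}+u^\delta$ are recorded on $[-\bar h,T]$, where $(x^{\rm nom},u^{\rm nom})$ satisfies (1) for $k=0,\dots,T-1$ with constant delays $h_1,h_2\in\{0,\dots,\bar h\}$, and $x^\delta,u^\delta$ is additive noise. Put $X_0=[x(0)\cdots x(T-1)]$, $X_1=[x(1)\cdots x(T)]$, $X_{h_1}=[x(-h_1)\cdots x(T-1-h_1)]$, $U_{h_2}=[u(-h_2)\cdots u(T-1-h_2)]$, $W_0=[U_{h_2}^\top\; X_{h_1}^\top\; X_0^\top]^\top$, and let $X_1^\delta$, $W_0^\delta$ be the same matrices built from the noise. Assume that $\operatorname{rank}W_0=m+2n$ and that $$\Delta=[\,B\;A_1\;A_0\,]\,W_0^\delta-X_1^\delta\quad\text{satisfies}\quad\|\Delta\|_2\le\alpha,\qquad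 \alpha>0 .$$ **Matrix inequalities.** Let $\varepsilon>0$, and suppose that there are $n\times n$ matrices $\bar P>0$, $\bar S>0$, $\bar R_i>0$ and $\bar S_{12,i}$ ($i=1,2$), $T\times n$ matrices $Q_1,Q_2,Q_3$, and $\lambda>0$ such that $$\begin{bmatrix}\bar\Phi-\alpha^2\lambda I_{5n}&\mathbf Q^\top\\ \mathbf Q&\lambda I_{5T}\end{bmatrix}>0,\qquad \begin{bmatrix}\bar R_i&\bar S_{12,i}\\ \bar S_{12,i}^\top&\bar R_i\end{bmatrix}\ge0\quad(i=1,2),$$ $$U_{h_2}Q_2=U_{h_2}Q_3=0,\quad X_{h_1}Q_1=X_{h_1}Q_3=0,\quad X_0Q_1=X_0Q_2=0,\quad X_{h_1}Q_2=X_0Q_3 .$$ Here $M>0$ ($M\ge 0$) means that $M$ is symmetric positive definite (semidefinite), $$\mathbf Q=\begin{bmatrix}Q_3&Q_2&Q_1&0&0\\0&0&0&0&0\\0&0&0&0&0\\0&0&0&0&0\\ \varepsilon Q_3&\varepsilon Q_2&\varepsilon Q_1&0&0\end{bmatrix},$$ and $\bar\Phi$ is the symmetric $5\times5$ block matrix with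 blocks on and above the diagonal $$\begin{aligned} \bar\Phi_{11}&=\bar P-\bar S+(1-\bar h^2)(\bar R_1+\bar R_2)-X_1Q_3-(X_1Q_3)^\top,\\ \bar\Phi_{12}&=-\bar R_1+\bar S_{12,1}-X_1Q_2,\quad \bar\Phi_{13}=-\bar R_2+\bar S_{12,2}-X_1Q_1,\quad \bar\Phi_{14}=-\bar S_{12,1}-\bar S_{12,2},\\ \bar\Phi_{15}&=\bar h^2(\bar R_1+\bar R_2)+X_0Q_3-\varepsilon(X_1Q_3)^\top,\\ \bar\Phi_{22}&=2\bar R_1-\bar S_{12,1}-\bar S_{12,1}^\top,\quad \bar\Phi_{23}=0,\quad \bar\Phi_{24}=-\bar R_1+\bar S_{12,1},\quad \bar\Phi_{25}=-\varepsilon(X_1Q_2)^\top,\\ \bar\Phi_{33}&=2\bar R_2-\bar S_{12,2}-\bar S_{12,2}^\top,\quad \bar\Phi_{34}=-\bar R_2+\bar S_{12,2},\quad \bar\Phi_{35}=-\varepsilon(X_1Q_1)^\top,\\ \bar\Phi_{44}&=\bar R_1+\bar R_2+\bar S,\quad \bar\Phi_{45}=0,\\ \bar\Phi_{55}&=-\bar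 P-\bar h^2(\bar R_1+\bar R_2)+\varepsilon\big(X_0Q_3+Q_3^\top X_0^\top\big). \end{aligned}$$ **Conclusion.** Then $X_0Q_3$ is invertible, and with the gain $K=U_{h_2}Q_1(X_0Q_3)^{-1}$ the origin of (1) in closed loop with $u(k)=Kx(k)$ is exponentially stable for all, possibly time-varying, integer delays $h_1(k),h_2(k)\in[0,\bar h]$: there are $M>0$ and $\rho\in(0,1)$ such that, for all such delays, for all initial data $x(j),u(j)$, $-\bar h\le j\le 0$ (in particular for zero past inputs), and for all $k\ge0$, the solution of (1) with $u(k)=Kx(k)$ for $k\ge 1$ satisfies $$\|x(k)\|_2\le M\rho^k\max_{-\bar h\le j\le0}\max\{\|x(j)\|_2,\|u(j)\|_2\}.$$ -/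

import Mathlib

open scoped Matrix

noncomputable section

namespace DelayControl

/-- The Euclidean norm `√(vᵀ v)` of a real column vector. -/
def euclNorm {n : ℕ} (v : Fin n → ℝ) : ℝ := Real.sqrt (v ⬝ᵥ v)

open scoped Matrix.Norms.L2Operator in
/-- The matrix norm induced by the Euclidean norms. -/
def specNorm {p q : Type*} [Fintype p] [Fintype q] [DecidableEq q] (A : Matrix p q ℝ) : ℝ := ‖A‖

/-! ### Recorded data -/

/-- The data matrix `[z(i) z(i+1) ⋯ z(T+i-1)]` of a signal `z`. -/
def dataMat {n : ℕ} (z : ℤ → Fin n → ℝ) (i : ℤ) (T : ℕ) : Matrix (Fin n) (Fin T) ℝ :=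
  Matrix.of fun r c => z (i + ((c : ℕ) : ℤ)) r

/-- The delayed signal `k ↦ z(k - h)` for a constant delay `h`. -/
def delayed {n : ℕ} (z : ℤ → Fin n → ℝ) (h : ℕ) : ℤ → Fin n → ℝ := fun k => z (k - (h : ℤ))

/-- The stacked data matrix with block rows `u(k - h₂)`, `x(k - h₁)`, `x(k)`, `k = 0, …, T - 1`. -/
def dataW {n m : ℕ} (u : ℤ → Fin m → ℝ) (x : ℤ → Fin n → ℝ) (h₁ h₂ T : ℕ) :
    Matrix (Fin m ⊕ (Fin n ⊕ Fin n)) (Fin T) ℝ :=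
  Matrix.fromRows (dataMat (delayed u h₂) 0 T)
    (Matrix.fromRows (dataMat (delayed x h₁) 0 T) (dataMat x 0 T))

/-- The block row `[B A₁ A₀]`. -/
def sysMat {n m : ℕ} (A₀ A₁ : Matrix (Fin n) (Fin n) ℝ) (B : Matrix (Fin n) (Fin m) ℝ) :
    Matrix (Fin n) (Fin m ⊕ (Fin n ⊕ Fin n)) ℝ :=
  Matrix.fromCols B (Matrix.fromCols A₁ A₀)

/-- On the recording window `k = 0, …, T - 1` the signals `x`, `u` satisfy
`x(k+1) = A₀ x(k) + A₁ x(k - h₁) + B u(k - h₂)` with constant delays. -/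
def IsTrajectoryOn {n m : ℕ} (A₀ A₁ : Matrix (Fin n) (Fin n) ℝ) (B : Matrix (Fin n) (Fin m) ℝ)
    (h₁ h₂ T : ℕ) (x : ℤ → Fin n → ℝ) (u : ℤ → Fin m → ℝ) : Prop :=
  ∀ k : ℕ, k < T →
    x ((k : ℤ) + 1) = A₀ *ᵥ x k + A₁ *ᵥ x ((k : ℤ) - h₁) + B *ᵥ u ((k : ℤ) - h₂)

/-- The mismatch `Δ = [B A₁ A₀] W₀^δ - X₁^δ` of the noise signals `xδ`, `uδ`. -/
def mismatch {n m : ℕ} (A₀ A₁ : Matrix (Fin n) (Fin n) ℝ) (B : Matrix (Fin n) (Fin m) ℝ)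
    (h₁ h₂ T : ℕ) (xδ : ℤ → Fin n → ℝ) (uδ : ℤ → Fin m → ℝ) : Matrix (Fin n) (Fin T) ℝ :=
  sysMat A₀ A₁ B * dataW uδ xδ h₁ h₂ T - dataMat xδ 1 T

/-! ### The matrix inequality -/

/-- The `5n × 5n` matrix `Φ̄`, with `X₀`, `X₁` the data matrices of `x(k)`, `x(k+1)`. -/
def Phi {n T : ℕ} (hbar : ℕ) (ε : ℝ) (X₀ X₁ : Matrix (Fin n) (Fin T) ℝ)
    (P S R₁ R₂ S₁ S₂ : Matrix (Fin n) (Fin n) ℝ) (Q₁ Q₂ Q₃ : Matrix (Fin T) (Fin n) ℝ) :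
    Matrix (Fin 5 × Fin n) (Fin 5 × Fin n) ℝ :=
  let F₁₁ := P - S + (1 - (hbar : ℝ) ^ 2) • (R₁ + R₂) - X₁ * Q₃ - (X₁ * Q₃)ᵀ
  let F₁₂ := -R₁ + S₁ - X₁ * Q₂
  let F₁₃ := -R₂ + S₂ - X₁ * Q₁
  let F₁₄ := -S₁ - S₂
  let F₁₅ := (hbar : ℝ) ^ 2 • (R₁ + R₂) + X₀ * Q₃ - ε • (X₁ * Q₃)ᵀ
  let F₂₂ := (2 : ℝ) • R₁ - S₁ - S₁ᵀ
  let F₂₄ := -R₁ + S₁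
  let F₂₅ := -(ε • (X₁ * Q₂)ᵀ)
  let F₃₃ := (2 : ℝ) • R₂ - S₂ - S₂ᵀ
  let F₃₄ := -R₂ + S₂
  let F₃₅ := -(ε • (X₁ * Q₁)ᵀ)
  let F₄₄ := R₁ + R₂ + S
  let F₅₅ := -P - (hbar : ℝ) ^ 2 • (R₁ + R₂) + ε • (X₀ * Q₃ + Q₃ᵀ * X₀ᵀ)
  Matrix.comp (Fin 5) (Fin 5) (Fin n) (Fin n) ℝ
    !![F₁₁,  F₁₂,  F₁₃,  F₁₄,  F₁₅;
       F₁₂ᵀ, F₂₂,  0,    F₂₄,  F₂₅;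
       F₁₃ᵀ, 0,    F₃₃,  F₃₄,  F₃₅;
       F₁₄ᵀ, F₂₄ᵀ, F₃₄ᵀ, F₄₄,  0;
       F₁₅ᵀ, F₂₅ᵀ, F₃₅ᵀ, 0,    F₅₅]

/-- The `5T × 5n` matrix `𝐐`. Its last block row carries the factor `ε`, so that
`diag(Δ,Δ,Δ,Δ,Δ) 𝐐` is the contribution of the mismatch `Δ` weighted by `x(k) + ε x(k+1)`. -/
def bigQ {n T : ℕ} (ε : ℝ) (Q₁ Q₂ Q₃ : Matrix (Fin T) (Fin n) ℝ) :
    Matrix (Fin 5 × Fin T) (Fin 5 × Fin n) ℝ :=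
  Matrix.comp (Fin 5) (Fin 5) (Fin T) (Fin n) ℝ
    !![Q₃,     Q₂,     Q₁,     0, 0;
       0,      0,      0,      0, 0;
       0,      0,      0,      0, 0;
       0,      0,      0,      0, 0;
       ε • Q₃, ε • Q₂, ε • Q₁, 0, 0]

/-- The augmented matrix `[Φ̄ - α²λ I, 𝐐ᵀ; 𝐐, λ I]`. -/
def augmented {n T : ℕ} (α lam : ℝ) (F : Matrix (Fin 5 × Fin n) (Fin 5 × Fin n) ℝ)
    (Q : Matrix (Fin 5 × Fin T) (Fin 5 × Fin n) ℝ) :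
    Matrix ((Fin 5 × Fin n) ⊕ (Fin 5 × Fin T)) ((Fin 5 × Fin n) ⊕ (Fin 5 × Fin T)) ℝ :=
  Matrix.fromBlocks (F - (α ^ 2 * lam) • 1) Qᵀ Q (lam • 1)

/-! ### The closed loop -/

/-- `x`, `u` is a solution for `k ≥ 0` of
`x(k+1) = A₀ x(k) + A₁ x(k - η₁(k)) + B u(k - η₂(k))` with feedback `u(k) = K x(k)`.
The values of `x` and `u` at the times `j ≤ 0` are initial data; the feedback acts from `k = 1` on.
Past inputs `u(j) = 0` and past inputs `u(j) = K x(j)` are special cases. -/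
def IsClosedLoopSolution {n m : ℕ} (A₀ A₁ : Matrix (Fin n) (Fin n) ℝ)
    (B : Matrix (Fin n) (Fin m) ℝ) (K : Matrix (Fin m) (Fin n) ℝ) (η₁ η₂ : ℕ → ℕ)
    (x : ℤ → Fin n → ℝ) (u : ℤ → Fin m → ℝ) : Prop :=
  (∀ k : ℕ, x ((k : ℤ) + 1) =
      A₀ *ᵥ x k + A₁ *ᵥ x ((k : ℤ) - η₁ k) + B *ᵥ u ((k : ℤ) - η₂ k)) ∧
  (∀ k : ℤ, 0 < k → u k = K *ᵥ x k)

/-- The maximum of `‖z(j)‖₂` over the initial interval `j = -h̄, …, 0`. -/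
def histNorm {n : ℕ} (hbar : ℕ) (z : ℤ → Fin n → ℝ) : ℝ :=
  (Finset.range (hbar + 1)).sup' Finset.nonempty_range_add_one fun j => euclNorm (z (-(j : ℤ)))

/-- The origin of the closed loop is exponentially stable, with constants `M`, `ρ` that serve
all (time-varying) delays with values in `[0, h̄]` and all initial data. -/
def ExpStable {n m : ℕ} (A₀ A₁ : Matrix (Fin n) (Fin n) ℝ) (B : Matrix (Fin n) (Fin m) ℝ)
    (K : Matrix (Fin m) (Fin n) ℝ) (hbar : ℕ) : Prop :=
  ∃ M ρ : ℝ, 0 < M ∧ 0 < ρ ∧ ρ < 1 ∧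
    ∀ η₁ η₂ : ℕ → ℕ, (∀ k, η₁ k ≤ hbar) → (∀ k, η₂ k ≤ hbar) →
      ∀ (x : ℤ → Fin n → ℝ) (u : ℤ → Fin m → ℝ), IsClosedLoopSolution A₀ A₁ B K η₁ η₂ x u →
        ∀ k : ℕ, euclNorm (x k) ≤ M * ρ ^ k * max (histNorm hbar x) (histNorm hbar u)

end DelayControl

end

namespace DelayControl

noncomputable section

/-! ### Quadratic forms on real coordinate spaces -/

section QuadraticForms

variable {ι κ : Type*} [Fintype ι] [Fintype κ]

/-! Write F = X₀Q₃ and Δ for the mismatch. The data satisfy X₁ = [B A₁ A₀]W₀ − Δ, so the equality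
constraints turn X₁Q₃, X₁Q₂, X₁Q₁ into A₀F, A₁F, BKF, each up to −ΔQᵢ (the last one once F is
invertible). In the coordinates g = F⁻¹x the matrix inequality thus speaks about the unknown closed
loop.

It is tested on (g(k), g(k−η₁), g(k−η₂), g(k−h̄), g(k+1)), completed by −(Δᵀg(k), 0, 0, 0,
Δᵀg(k+1)). The terms linear in Δ cancel, ‖Δ‖ ≤ α absorbs the quadratic ones, and the descriptor
terms vanish along solutions (`lmi_estimate`). Keeping only the last state block, taken in ker F,
gives ker F = 0.

What is left is the decrease of a Lyapunov–Krasovskii functional, after `reciprocally_convex_sum_le`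
bounds the delayed differences. This controls only |g(k)|²; a small extra weighted sum in `lyap`
spreads the control over the whole window, so the functional contracts geometrically, uniformly in
the delays (`exists_exponential_decay`). Times at which the input may still be initial data are
covered by `exists_growth_bound`. -/

theorem dotProduct_mulVec_transpose (A : Matrix ι κ ℝ) (v : κ → ℝ) (w : ι → ℝ) :
    v ⬝ᵥ (Aᵀ *ᵥ w) = w ⬝ᵥ (A *ᵥ v) := by
  rw [Matrix.mulVec_transpose, dotProduct_comm, ← Matrix.dotProduct_mulVec]

theorem dotProduct_mulVec_comm {A : Matrix ι ι ℝ} (hA : A.IsHermitian) (v w : ι → ℝ) :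
    v ⬝ᵥ (A *ᵥ w) = w ⬝ᵥ (A *ᵥ v) := by
  have h : Aᵀ = A := by simpa using hA.eq
  conv_lhs => rw [← h]
  exact dotProduct_mulVec_transpose A v w

theorem dotProduct_self_nonneg' (v : ι → ℝ) : 0 ≤ v ⬝ᵥ v :=
  Finset.sum_nonneg fun i _ => mul_self_nonneg (v i)

theorem isCompact_unit_dotProduct : IsCompact {v : ι → ℝ | v ⬝ᵥ v = 1} := by
  refine Metric.isCompact_of_isClosed_isBounded
    (isClosed_eq (by unfold dotProduct; fun_prop) continuous_const) ?_
  refine (Metric.isBounded_closedBall (x := (0 : ι → ℝ)) (r := 1)).subset fun v hv => ?_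
  rw [mem_closedBall_zero_iff, pi_norm_le_iff_of_nonneg zero_le_one]
  intro i
  have h1 : v i * v i ≤ v ⬝ᵥ v :=
    Finset.single_le_sum (f := fun i => v i * v i) (fun i _ => mul_self_nonneg (v i))
      (Finset.mem_univ i)
  rw [show v ⬝ᵥ v = 1 from hv] at h1
  rw [Real.norm_eq_abs, abs_le]
  constructor <;> nlinarith

/-- Both bounds for a quadratic form follow from the unit sphere by homogeneity. -/
theorem quadForm_bound_of_unit {A : Matrix ι ι ℝ} {c : ℝ}
    (h : ∀ v : ι → ℝ, v ⬝ᵥ v = 1 → c ≤ v ⬝ᵥ (A *ᵥ v)) (v : ι → ℝ) :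
    c * (v ⬝ᵥ v) ≤ v ⬝ᵥ (A *ᵥ v) := by
  rcases (dotProduct_self_nonneg' v).eq_or_lt with h0 | h0
  · have : v = 0 := dotProduct_self_eq_zero.mp h0.symm
    simp [this]
  · set s := Real.sqrt (v ⬝ᵥ v)
    have hs : s * s = v ⬝ᵥ v := Real.mul_self_sqrt h0.le
    have hs0 : 0 < s := Real.sqrt_pos.mpr h0
    have h1 := h (s⁻¹ • v) (by
      rw [smul_dotProduct, dotProduct_smul, smul_eq_mul, smul_eq_mul, ← hs]
      field_simp)
    rw [Matrix.mulVec_smul, smul_dotProduct, dotProduct_smul, smul_eq_mul, smul_eq_mul] at h1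
    rw [← hs]
    calc c * (s * s) ≤ (s⁻¹ * (s⁻¹ * (v ⬝ᵥ (A *ᵥ v)))) * (s * s) := by gcongr
      _ = v ⬝ᵥ (A *ᵥ v) := by field_simp

theorem exists_pos_mul_le_quadForm {A : Matrix ι ι ℝ} (hA : A.PosDef) :
    ∃ c : ℝ, 0 < c ∧ ∀ v : ι → ℝ, c * (v ⬝ᵥ v) ≤ v ⬝ᵥ (A *ᵥ v) := by
  by_cases hne : {v : ι → ℝ | v ⬝ᵥ v = 1}.Nonempty
  · obtain ⟨w, hw, hmin⟩ := isCompact_unit_dotProduct.exists_isMinOn hne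
      (f := fun v : ι → ℝ => v ⬝ᵥ (A *ᵥ v))
      (by unfold Matrix.mulVec dotProduct; fun_prop)
    refine ⟨w ⬝ᵥ (A *ᵥ w), ?_, quadForm_bound_of_unit fun v hv => hmin hv⟩
    have hw0 : w ≠ 0 := by
      rintro rfl
      simp at hw
    simpa using hA.dotProduct_mulVec_pos hw0
  -- The unit sphere is empty (zero-dimensional space), so any positive constant works.
  · refine ⟨1, one_pos, quadForm_bound_of_unit fun v hv => absurd ⟨v, hv⟩ hne⟩

theorem exists_quadForm_le (A : Matrix ι ι ℝ) :
    ∃ C : ℝ, 0 ≤ C ∧ ∀ v : ι → ℝ, v ⬝ᵥ (A *ᵥ v) ≤ C * (v ⬝ᵥ v) := by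
  obtain ⟨C, hC⟩ := (isCompact_unit_dotProduct (ι := ι)).bddAbove_image
    (f := fun v : ι → ℝ => v ⬝ᵥ (A *ᵥ v)) (by unfold Matrix.mulVec dotProduct; fun_prop)
  refine ⟨max C 0, le_max_right _ _, fun v => ?_⟩
  have := quadForm_bound_of_unit (A := -A) (c := -max C 0) (fun w hw => by
    have : w ⬝ᵥ (A *ᵥ w) ≤ C := hC ⟨w, hw, rfl⟩
    rw [Matrix.neg_mulVec, dotProduct_neg]
    linarith [le_max_left C 0]) v
  rw [Matrix.neg_mulVec, dotProduct_neg] at this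
  linarith

theorem dotProduct_mulVec_nonneg_of_posSemidef {A : Matrix ι ι ℝ} (hA : A.PosSemidef)
    (v : ι → ℝ) : 0 ≤ v ⬝ᵥ (A *ᵥ v) := by
  simpa using hA.dotProduct_mulVec_nonneg v

end QuadraticForms

/-! ### Euclidean and spectral norms -/

theorem euclNorm_eq_norm {n : ℕ} (v : Fin n → ℝ) : euclNorm v = ‖WithLp.toLp 2 v‖ := by
  rw [euclNorm, EuclideanSpace.norm_eq]
  simp [dotProduct, sq]

theorem euclNorm_nonneg {n : ℕ} (v : Fin n → ℝ) : 0 ≤ euclNorm v := Real.sqrt_nonneg _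

theorem euclNorm_sq {n : ℕ} (v : Fin n → ℝ) : euclNorm v ^ 2 = v ⬝ᵥ v :=
  Real.sq_sqrt (dotProduct_self_nonneg' v)

theorem euclNorm_add_le {n : ℕ} (v w : Fin n → ℝ) : euclNorm (v + w) ≤ euclNorm v + euclNorm w := by
  simpa [euclNorm_eq_norm] using norm_add_le (WithLp.toLp 2 v) (WithLp.toLp 2 w)

theorem euclNorm_mulVec_le {p q : ℕ} (A : Matrix (Fin p) (Fin q) ℝ) (v : Fin q → ℝ) :
    euclNorm (A *ᵥ v) ≤ specNorm A * euclNorm v := by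
  rw [euclNorm_eq_norm, euclNorm_eq_norm, specNorm]
  exact A.l2_opNorm_mulVec (WithLp.toLp 2 v)

theorem specNorm_nonneg {p q : ℕ} (A : Matrix (Fin p) (Fin q) ℝ) : 0 ≤ specNorm A := by
  rw [specNorm, Matrix.l2_opNorm_def]
  exact norm_nonneg _

theorem specNorm_transpose {p q : ℕ} (A : Matrix (Fin p) (Fin q) ℝ) :
    specNorm Aᵀ = specNorm A := by
  have h := Matrix.l2_opNorm_conjTranspose (𝕜 := ℝ) A
  rwa [Matrix.conjTranspose_eq_transpose_of_trivial] at h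

theorem transpose_mulVec_self_le {p q : ℕ} {D : Matrix (Fin p) (Fin q) ℝ} {α : ℝ}
    (hD : specNorm D ≤ α) (v : Fin p → ℝ) :
    (Dᵀ *ᵥ v) ⬝ᵥ (Dᵀ *ᵥ v) ≤ α ^ 2 * (v ⬝ᵥ v) := by
  rw [← euclNorm_sq, ← euclNorm_sq, ← mul_pow]
  refine pow_le_pow_left₀ (euclNorm_nonneg _) ((euclNorm_mulVec_le _ _).trans ?_) 2
  rw [specNorm_transpose]
  exact mul_le_mul_of_nonneg_right hD (euclNorm_nonneg _)

/-! ### Summation inequalities -/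

section Summation

variable {ι κ σ : Type*} [Fintype ι]

theorem sum_dotProduct_mulVec_sum (S : Matrix ι ι ℝ) (I : Finset κ) (J : Finset σ)
    (f : κ → ι → ℝ) (g : σ → ι → ℝ) :
    (∑ i ∈ I, f i) ⬝ᵥ (S *ᵥ ∑ j ∈ J, g j) = ∑ i ∈ I, ∑ j ∈ J, f i ⬝ᵥ (S *ᵥ g j) := by
  rw [sum_dotProduct]
  refine Finset.sum_congr rfl fun i _ => ?_
  rw [Matrix.mulVec_sum, dotProduct_sum]

/-- Summing a pointwise estimate of a bilinear form over a product of index sets. -/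
theorem bilinear_sum_le {R S : Matrix ι ι ℝ}
    (h : ∀ v w : ι → ℝ, 2 * (v ⬝ᵥ (S *ᵥ w)) ≤ v ⬝ᵥ (R *ᵥ v) + w ⬝ᵥ (R *ᵥ w))
    (I : Finset κ) (J : Finset σ) (f : κ → ι → ℝ) (g : σ → ι → ℝ) :
    2 * ((∑ i ∈ I, f i) ⬝ᵥ (S *ᵥ ∑ j ∈ J, g j)) ≤
      J.card * ∑ i ∈ I, f i ⬝ᵥ (R *ᵥ f i) + I.card * ∑ j ∈ J, g j ⬝ᵥ (R *ᵥ g j) := by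
  rw [sum_dotProduct_mulVec_sum, Finset.mul_sum]
  calc ∑ i ∈ I, 2 * ∑ j ∈ J, f i ⬝ᵥ (S *ᵥ g j)
      ≤ ∑ i ∈ I, ∑ j ∈ J, (f i ⬝ᵥ (R *ᵥ f i) + g j ⬝ᵥ (R *ᵥ g j)) := by
        refine Finset.sum_le_sum fun i _ => ?_
        rw [Finset.mul_sum]
        exact Finset.sum_le_sum fun j _ => h _ _
    _ = _ := by
        simp [Finset.sum_add_distrib, Finset.mul_sum]

theorem two_mul_dotProduct_mulVec_le {R : Matrix ι ι ℝ} (hR : R.PosSemidef) (v w : ι → ℝ) :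
    2 * (v ⬝ᵥ (R *ᵥ w)) ≤ v ⬝ᵥ (R *ᵥ v) + w ⬝ᵥ (R *ᵥ w) := by
  have h := dotProduct_mulVec_nonneg_of_posSemidef hR (v - w)
  rw [Matrix.mulVec_sub, sub_dotProduct, dotProduct_sub, dotProduct_sub,
    dotProduct_mulVec_comm hR.isHermitian w v] at h
  linarith

/-- Nonnegativity of the block form at (v, −w). -/
theorem two_mul_dotProduct_mulVec_le_of_fromBlocks {R S : Matrix ι ι ℝ}
    (h : (Matrix.fromBlocks R S Sᵀ R).PosSemidef) (v w : ι → ℝ) :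
    2 * (v ⬝ᵥ (S *ᵥ w)) ≤ v ⬝ᵥ (R *ᵥ v) + w ⬝ᵥ (R *ᵥ w) := by
  have h := dotProduct_mulVec_nonneg_of_posSemidef h (Sum.elim v (-w))
  rw [Matrix.fromBlocks_mulVec, sumElim_dotProduct_sumElim] at h
  simp only [Sum.elim_comp_inl, Sum.elim_comp_inr, dotProduct_add, neg_dotProduct,
    Matrix.mulVec_neg, dotProduct_neg, dotProduct_mulVec_transpose] at h
  linarith

/-- Discrete Jensen inequality combined with the reciprocally convex combination lemma. -/
theorem reciprocally_convex_sum_le {R S : Matrix ι ι ℝ} (hR : R.PosSemidef)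
    (h : (Matrix.fromBlocks R S Sᵀ R).PosSemidef)
    (I : Finset κ) (J : Finset σ) (f : κ → ι → ℝ) (g : σ → ι → ℝ) :
    (∑ i ∈ I, f i) ⬝ᵥ (R *ᵥ ∑ i ∈ I, f i) + (∑ j ∈ J, g j) ⬝ᵥ (R *ᵥ ∑ j ∈ J, g j)
        + 2 * ((∑ i ∈ I, f i) ⬝ᵥ (S *ᵥ ∑ j ∈ J, g j)) ≤
      (I.card + J.card : ℝ) *
        (∑ i ∈ I, f i ⬝ᵥ (R *ᵥ f i) + ∑ j ∈ J, g j ⬝ᵥ (R *ᵥ g j)) := by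
  -- Summing over I × I, J × J and I × J makes the cardinalities add up to |I| + |J|. No division by
  -- a length occurs, so empty windows (delay 0 or h̄) need no separate case.
  have h1 := bilinear_sum_le (two_mul_dotProduct_mulVec_le hR) I I f f
  have h2 := bilinear_sum_le (two_mul_dotProduct_mulVec_le hR) J J g g
  have h3 := bilinear_sum_le (two_mul_dotProduct_mulVec_le_of_fromBlocks h) I J f g
  linarith

end Summation

/-! ### Evaluating the block matrix inequality -/

theorem uncurry_dotProduct_uncurry {ι κ : Type*} [Fintype ι] [Fintype κ] (a b : ι → κ → ℝ) :
    Function.uncurry a ⬝ᵥ Function.uncurry b = ∑ i, a i ⬝ᵥ b i := by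
  simp [dotProduct, Fintype.sum_prod_type, Function.uncurry]

theorem comp_mulVec_uncurry {ι κ σ τ : Type*} [Fintype κ] [Fintype τ]
    (M : Matrix ι κ (Matrix σ τ ℝ)) (b : κ → τ → ℝ) :
    Matrix.comp ι κ σ τ ℝ M *ᵥ Function.uncurry b =
      Function.uncurry fun i => ∑ j, M i j *ᵥ b j := by
  ext ⟨i, s⟩
  simp only [Matrix.mulVec, dotProduct, Fintype.sum_prod_type, Function.uncurry, Finset.sum_apply]
  rfl

theorem augmented_quadForm {n T : ℕ} (α lam : ℝ) (F : Matrix (Fin 5 × Fin n) (Fin 5 × Fin n) ℝ)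
    (Q : Matrix (Fin 5 × Fin T) (Fin 5 × Fin n) ℝ) (v : Fin 5 × Fin n → ℝ)
    (w : Fin 5 × Fin T → ℝ) :
    Sum.elim v w ⬝ᵥ (augmented α lam F Q *ᵥ Sum.elim v w) =
      v ⬝ᵥ (F *ᵥ v) - α ^ 2 * lam * (v ⬝ᵥ v) + 2 * (w ⬝ᵥ (Q *ᵥ v)) + lam * (w ⬝ᵥ w) := by
  rw [augmented, Matrix.fromBlocks_mulVec, sumElim_dotProduct_sumElim]
  simp only [Sum.elim_comp_inl, Sum.elim_comp_inr, dotProduct_add, dotProduct_mulVec_transpose,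
    Matrix.sub_mulVec, dotProduct_sub, Matrix.smul_mulVec, Matrix.one_mulVec, dotProduct_smul,
    smul_eq_mul]
  ring

/-- The lower bound of the reciprocally convex combination lemma, `h` times the integral term. -/
def recipForm {n : ℕ} (R S : Matrix (Fin n) (Fin n) ℝ) (a b : Fin n → ℝ) : ℝ :=
  a ⬝ᵥ (R *ᵥ a) + b ⬝ᵥ (R *ᵥ b) + 2 * (a ⬝ᵥ (S *ᵥ b))

/-- The matrix inequality, evaluated along the descriptor form of the uncertain system. -/
theorem lmi_estimate {n T hbar : ℕ} {α ε lam c : ℝ} {X₀ X₁ D : Matrix (Fin n) (Fin T) ℝ}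
    {P S R₁ R₂ S₁ S₂ N₁ N₂ N₃ : Matrix (Fin n) (Fin n) ℝ} {Q₁ Q₂ Q₃ : Matrix (Fin T) (Fin n) ℝ}
    (hR₁ : R₁.IsHermitian) (hR₂ : R₂.IsHermitian)
    (hlam : 0 < lam) (hD : specNorm D ≤ α)
    (hX₁ : X₁ * Q₁ = N₁ - D * Q₁) (hX₂ : X₁ * Q₂ = N₂ - D * Q₂) (hX₃ : X₁ * Q₃ = N₃ - D * Q₃)
    (hc : 0 < c)
    (h : ∀ v, c * (v ⬝ᵥ v) ≤ v ⬝ᵥ (augmented α lam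
      (Phi hbar ε X₀ X₁ P S R₁ R₂ S₁ S₂ Q₁ Q₂ Q₃) (bigQ ε Q₁ Q₂ Q₃) *ᵥ v))
    (z z₁ z₂ zh y : Fin n → ℝ)
    (hy : (X₀ * Q₃) *ᵥ y = N₃ *ᵥ z + N₂ *ᵥ z₁ + N₁ *ᵥ z₂) :
    c * (z ⬝ᵥ z) ≤ z ⬝ᵥ (P *ᵥ z) - y ⬝ᵥ (P *ᵥ y) - z ⬝ᵥ (S *ᵥ z) + zh ⬝ᵥ (S *ᵥ zh)
      - (hbar : ℝ) ^ 2 * ((y - z) ⬝ᵥ (R₁ *ᵥ (y - z)) + (y - z) ⬝ᵥ (R₂ *ᵥ (y - z)))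
      + recipForm R₁ S₁ (z - z₁) (z₁ - zh) + recipForm R₂ S₂ (z - z₂) (z₂ - zh) := by
  -- The lower block makes 2wᵀ𝐐v cancel the D-terms that enter Φ̄ through X₁Qᵢ = Nᵢ − DQᵢ.
  have key := h (Sum.elim (Function.uncurry ![z, z₁, z₂, zh, y])
    (Function.uncurry ![-(Dᵀ *ᵥ z), 0, 0, 0, -(Dᵀ *ᵥ y)]))
  rw [augmented_quadForm, sumElim_dotProduct_sumElim] at key
  have hz := mul_le_mul_of_nonneg_left (transpose_mulVec_self_le hD z) hlam.le
  have hyy := mul_le_mul_of_nonneg_left (transpose_mulVec_self_le hD y) hlam.le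
  -- Descriptor method: the system equation is paired with z and, weighted by ε, with y.
  have e1 := congrArg (z ⬝ᵥ ·) hy
  have e2 := congrArg (y ⬝ᵥ ·) hy
  have n0 (m : ℕ) (v : Fin m → ℝ) : 0 ≤ c * (v ⬝ᵥ v) := mul_nonneg hc.le (dotProduct_self_nonneg' v)
  have m0 (v : Fin n → ℝ) : 0 ≤ α ^ 2 * lam * (v ⬝ᵥ v) :=
    mul_nonneg (by positivity) (dotProduct_self_nonneg' v)
  have hDt (v : Fin n → ℝ) (w : Fin T → ℝ) : (Dᵀ *ᵥ v) ⬝ᵥ w = v ⬝ᵥ (D *ᵥ w) := by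
    rw [dotProduct_comm, dotProduct_mulVec_transpose]
  rw [Phi, bigQ, comp_mulVec_uncurry, comp_mulVec_uncurry] at key
  simp only [uncurry_dotProduct_uncurry, Fin.sum_univ_five, hX₁, hX₂, hX₃,
    ← Matrix.transpose_mul] at key
  generalize X₀ * Q₃ = F at *
  simp only [Matrix.of_apply, Matrix.cons_val', Matrix.cons_val_zero, Matrix.cons_val_one,
    Matrix.cons_val, Matrix.cons_val_fin_one] at key
  simp only [recipForm, dotProduct_add, dotProduct_sub, dotProduct_neg, neg_dotProduct, sub_dotProduct, 
    Matrix.mulVec_sub, Matrix.add_mulVec, Matrix.sub_mulVec, Matrix.neg_mulVec,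
    Matrix.smul_mulVec, dotProduct_smul, smul_eq_mul, Matrix.zero_mulVec, dotProduct_zero,
    Matrix.transpose_add, Matrix.transpose_sub, Matrix.transpose_neg,
    Matrix.transpose_smul, Matrix.transpose_transpose,
    dotProduct_mulVec_transpose, ← Matrix.mulVec_mulVec, hDt] at key e1 e2 hz hyy ⊢
  have e3 := congrArg (fun t => ε * t) e2
  simp only [mul_add] at e3
  have d0 (v : Fin n → ℝ) : 0 ≤ c * (v ⬝ᵥ (D *ᵥ (Dᵀ *ᵥ v))) := by
    rw [← hDt]
    exact n0 T _
  rw [dotProduct_mulVec_comm hR₁ y z, dotProduct_mulVec_comm hR₁ z₁ z,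
    dotProduct_mulVec_comm hR₁ zh z₁, dotProduct_mulVec_comm hR₂ y z,
    dotProduct_mulVec_comm hR₂ z₂ z, dotProduct_mulVec_comm hR₂ zh z₂]
  linarith [n0 n z₁, n0 n z₂, n0 n zh, n0 n y, d0 z, d0 y, m0 z₁, m0 z₂, m0 zh]

/-! ### Identities for the recorded data -/

section Data

variable {n m T hbar h₁ h₂ : ℕ}

/-- The nominal parts cancel exactly, so all noise is collected in the mismatch. The delays are at
most h̄, so every sample used lies in the recording window. -/
theorem dataMat_one_eq (hh₁ : h₁ ≤ hbar) (hh₂ : h₂ ≤ hbar)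
    {A₀ A₁ : Matrix (Fin n) (Fin n) ℝ} {B : Matrix (Fin n) (Fin m) ℝ}
    {x xnom xδ : ℤ → Fin n → ℝ} {u unom uδ : ℤ → Fin m → ℝ}
    (hx : ∀ k : ℤ, -(hbar : ℤ) ≤ k → k ≤ T → x k = xnom k + xδ k)
    (hu : ∀ k : ℤ, -(hbar : ℤ) ≤ k → k ≤ T → u k = unom k + uδ k)
    (hnom : IsTrajectoryOn A₀ A₁ B h₁ h₂ T xnom unom) :
    dataMat x 1 T = sysMat A₀ A₁ B * dataW u x h₁ h₂ T - mismatch A₀ A₁ B h₁ h₂ T xδ uδ := by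
  have hW : dataW u x h₁ h₂ T = dataW unom xnom h₁ h₂ T + dataW uδ xδ h₁ h₂ T := by
    ext i c
    have hc : (c : ℤ) < T := by exact_mod_cast c.2
    rcases i with i | i | i
    · exact congrFun (hu (0 + c - h₂) (by omega) (by omega)) i
    · exact congrFun (hx (0 + c - h₁) (by omega) (by omega)) i
    · exact congrFun (hx (0 + c) (by omega) (by omega)) i
  have hX : dataMat x 1 T = dataMat xnom 1 T + dataMat xδ 1 T := by
    ext i c
    have hc : (c : ℤ) < T := by exact_mod_cast c.2
    exact congrFun (hx (1 + c) (by omega) (by omega)) i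
  have hN : dataMat xnom 1 T = sysMat A₀ A₁ B * dataW unom xnom h₁ h₂ T := by
    rw [sysMat, dataW, Matrix.fromCols_mul_fromRows, Matrix.fromCols_mul_fromRows]
    ext i c
    have h := congrFun (hnom c c.2) i
    rw [add_comm (c : ℤ) 1] at h
    simp only [Pi.add_apply, Matrix.mulVec, dotProduct] at h
    simp only [Matrix.add_apply, Matrix.mul_apply, dataMat, delayed, Matrix.of_apply, h, zero_add]
    ring
  rw [mismatch, hX, hW, hN, Matrix.mul_add]
  abel

theorem sysMat_mul_dataW_mul (A₀ A₁ : Matrix (Fin n) (Fin n) ℝ) (B : Matrix (Fin n) (Fin m) ℝ)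
    (x : ℤ → Fin n → ℝ) (u : ℤ → Fin m → ℝ) (Q : Matrix (Fin T) (Fin n) ℝ) :
    sysMat A₀ A₁ B * dataW u x h₁ h₂ T * Q =
      B * (dataMat (delayed u h₂) 0 T * Q) + (A₁ * (dataMat (delayed x h₁) 0 T * Q)
        + A₀ * (dataMat x 0 T * Q)) := by
  rw [sysMat, dataW, Matrix.fromCols_mul_fromRows, Matrix.fromCols_mul_fromRows]
  simp only [Matrix.add_mul, Matrix.mul_assoc]

end Data

/-! ### The Lyapunov functional -/

section Lyapunov

variable {n : ℕ}

/-- The integral inequality for a window split into lengths `d` and `τ`. -/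
theorem recipForm_le_sum {R S : Matrix (Fin n) (Fin n) ℝ} (hR : R.PosSemidef)
    (h : (Matrix.fromBlocks R S Sᵀ R).PosSemidef) (g : ℕ → Fin n → ℝ) (d τ : ℕ) :
    recipForm R S (g (d + τ) - g d) (g d - g 0) ≤
      ((d + τ : ℕ) : ℝ) *
        ∑ i ∈ Finset.range (d + τ), (g (i + 1) - g i) ⬝ᵥ (R *ᵥ (g (i + 1) - g i)) := by
  have key := reciprocally_convex_sum_le hR h (Finset.range τ) (Finset.range d)
    (fun i => g (d + (i + 1)) - g (d + i)) (fun i => g (i + 1) - g i)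
  rw [Finset.sum_range_sub (fun i => g (d + i)), Finset.sum_range_sub g, Finset.card_range,
    Finset.card_range, add_zero] at key
  rw [Finset.sum_range_add, Nat.cast_add]
  simp only [← add_assoc] at key
  rw [recipForm]
  linarith

/-- The weighted window sum of the double-sum Lyapunov terms. -/
def weightedSum (h : ℕ) (f : ℕ → ℝ) : ℝ := ∑ i ∈ Finset.range h, ((i : ℝ) + 1) * f i

/-- Summation by parts: a shift lowers each weight by one, and the new sample enters with weight h.
-/
theorem weightedSum_shift (h : ℕ) (f : ℕ → ℝ) :
    weightedSum h (fun i => f (i + 1)) =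
      weightedSum h f + h * f h - ∑ i ∈ Finset.range h, f i := by
  induction h with
  | zero => simp [weightedSum]
  | succ h ih =>
    simp only [weightedSum, Finset.sum_range_succ] at ih ⊢
    push_cast
    linarith

theorem weightedSum_nonneg {h : ℕ} {f : ℕ → ℝ} (hf : ∀ i, 0 ≤ f i) : 0 ≤ weightedSum h f :=
  Finset.sum_nonneg fun i _ => mul_nonneg (by positivity) (hf i)

theorem weightedSum_le {h : ℕ} {f : ℕ → ℝ} {b : ℝ} (hb : 0 ≤ b) (hf : ∀ i < h, f i ≤ b) :
    weightedSum h f ≤ (h : ℝ) ^ 2 * b := by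
  calc weightedSum h f ≤ ∑ _i ∈ Finset.range h, (h : ℝ) * b := by
        refine Finset.sum_le_sum fun i hi => ?_
        have hi' : i < h := Finset.mem_range.mp hi
        have : (i : ℝ) + 1 ≤ h := by exact_mod_cast hi'
        exact (mul_le_mul_of_nonneg_left (hf i hi') (by positivity)).trans
          (mul_le_mul_of_nonneg_right this hb)
    _ = (h : ℝ) ^ 2 * b := by
        rw [Finset.sum_const, Finset.card_range, nsmul_eq_mul]
        ring

/-- The Lyapunov–Krasovskii functional of the window `g 0, …, g h` of past states. -/
def lyap (h : ℕ) (P S R : Matrix (Fin n) (Fin n) ℝ) (μ : ℝ) (g : ℕ → Fin n → ℝ) : ℝ :=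
  g h ⬝ᵥ (P *ᵥ g h) + ∑ i ∈ Finset.range h, g i ⬝ᵥ (S *ᵥ g i)
    + h * weightedSum h (fun i => (g (i + 1) - g i) ⬝ᵥ (R *ᵥ (g (i + 1) - g i)))
    + μ * weightedSum h (fun i => g i ⬝ᵥ g i)

theorem lyap_shift (h : ℕ) (P S R : Matrix (Fin n) (Fin n) ℝ) (μ : ℝ) (g : ℕ → Fin n → ℝ) :
    lyap h P S R μ (fun i => g (i + 1)) = lyap h P S R μ g
      + g (h + 1) ⬝ᵥ (P *ᵥ g (h + 1)) - g h ⬝ᵥ (P *ᵥ g h)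
      + g h ⬝ᵥ (S *ᵥ g h) - g 0 ⬝ᵥ (S *ᵥ g 0)
      + h * (h * ((g (h + 1) - g h) ⬝ᵥ (R *ᵥ (g (h + 1) - g h)))
        - ∑ i ∈ Finset.range h, (g (i + 1) - g i) ⬝ᵥ (R *ᵥ (g (i + 1) - g i)))
      + μ * (h * (g h ⬝ᵥ g h) - ∑ i ∈ Finset.range h, g i ⬝ᵥ g i) := by
  have e1 := weightedSum_shift h (fun i => (g (i + 1) - g i) ⬝ᵥ (R *ᵥ (g (i + 1) - g i)))
  have e2 := weightedSum_shift h (fun i => g i ⬝ᵥ g i)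
  have e3 : ∑ i ∈ Finset.range h, g (i + 1) ⬝ᵥ (S *ᵥ g (i + 1)) =
      ∑ i ∈ Finset.range h, g i ⬝ᵥ (S *ᵥ g i) + g h ⬝ᵥ (S *ᵥ g h) - g 0 ⬝ᵥ (S *ᵥ g 0) := by
    rw [← Finset.sum_range_succ (fun i => g i ⬝ᵥ (S *ᵥ g i)),
      Finset.sum_range_succ' (fun i => g i ⬝ᵥ (S *ᵥ g i)), add_sub_cancel_right]
  rw [lyap, lyap]
  rw [e1, e2, e3]
  ring

theorem quadForm_le_lyap {h : ℕ} {P S R : Matrix (Fin n) (Fin n) ℝ} {μ : ℝ}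
    (hS : S.PosSemidef) (hR : R.PosSemidef) (hμ : 0 ≤ μ) (g : ℕ → Fin n → ℝ) :
    g h ⬝ᵥ (P *ᵥ g h) ≤ lyap h P S R μ g := by
  have h1 : 0 ≤ ∑ i ∈ Finset.range h, g i ⬝ᵥ (S *ᵥ g i) :=
    Finset.sum_nonneg fun i _ => dotProduct_mulVec_nonneg_of_posSemidef hS _
  have h2 : 0 ≤ h * weightedSum h (fun i => (g (i + 1) - g i) ⬝ᵥ (R *ᵥ (g (i + 1) - g i))) :=
    mul_nonneg (Nat.cast_nonneg h)
      (weightedSum_nonneg fun i => dotProduct_mulVec_nonneg_of_posSemidef hR _)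
  have h3 : 0 ≤ μ * weightedSum h (fun i => g i ⬝ᵥ g i) :=
    mul_nonneg hμ (weightedSum_nonneg fun i => dotProduct_self_nonneg' _)
  rw [lyap]
  linarith

theorem sub_dotProduct_self_le (v w : Fin n → ℝ) :
    (v - w) ⬝ᵥ (v - w) ≤ 2 * (v ⬝ᵥ v + w ⬝ᵥ w) := by
  have h := dotProduct_self_nonneg' (v + w)
  rw [add_dotProduct, dotProduct_add, dotProduct_add] at h
  rw [sub_dotProduct, dotProduct_sub, dotProduct_sub]
  linarith

theorem exists_lyap_le (h : ℕ) (P S R : Matrix (Fin n) (Fin n) ℝ) {μ : ℝ} (hμ : 0 ≤ μ) :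
    ∃ C : ℝ, 0 < C ∧ ∀ g : ℕ → Fin n → ℝ,
      lyap h P S R μ g ≤ C * ∑ i ∈ Finset.range (h + 1), g i ⬝ᵥ g i := by
  obtain ⟨p, hp, hP⟩ := exists_quadForm_le P
  obtain ⟨s, hs, hS⟩ := exists_quadForm_le S
  obtain ⟨r, hr, hR⟩ := exists_quadForm_le R
  refine ⟨p + s + h * ((h : ℝ) ^ 2 * (r * 4)) + μ * (h : ℝ) ^ 2 + 1, by positivity, fun g => ?_⟩
  set E := ∑ i ∈ Finset.range (h + 1), g i ⬝ᵥ g i with hE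
  have hle : ∀ i < h + 1, g i ⬝ᵥ g i ≤ E := fun i hi =>
    Finset.single_le_sum (f := fun i => g i ⬝ᵥ g i) (fun j _ => dotProduct_self_nonneg' (g j))
      (Finset.mem_range.mpr hi)
  have hE0 : 0 ≤ E := Finset.sum_nonneg fun j _ => dotProduct_self_nonneg' (g j)
  have t1 : g h ⬝ᵥ (P *ᵥ g h) ≤ p * E :=
    (hP _).trans (mul_le_mul_of_nonneg_left (hle h (by omega)) hp)
  have t2 : ∑ i ∈ Finset.range h, g i ⬝ᵥ (S *ᵥ g i) ≤ s * E := by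
    calc _ ≤ ∑ i ∈ Finset.range h, s * (g i ⬝ᵥ g i) := Finset.sum_le_sum fun i _ => hS _
      _ = s * ∑ i ∈ Finset.range h, g i ⬝ᵥ g i := by rw [Finset.mul_sum]
      _ ≤ s * E := by
        refine mul_le_mul_of_nonneg_left ?_ hs
        rw [hE, Finset.sum_range_succ]
        linarith [dotProduct_self_nonneg' (g h)]
  have t3 : weightedSum h (fun i => (g (i + 1) - g i) ⬝ᵥ (R *ᵥ (g (i + 1) - g i))) ≤
      (h : ℝ) ^ 2 * (r * 4 * E) := by
    refine weightedSum_le (by positivity) fun i hi => ?_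
    calc _ ≤ r * ((g (i + 1) - g i) ⬝ᵥ (g (i + 1) - g i)) := hR _
      _ ≤ r * (4 * E) := by
        refine mul_le_mul_of_nonneg_left ?_ hr
        linarith [sub_dotProduct_self_le (g (i + 1)) (g i), hle i (by omega),
          hle (i + 1) (by omega)]
      _ = r * 4 * E := by ring
  have t4 : weightedSum h (fun i => g i ⬝ᵥ g i) ≤ (h : ℝ) ^ 2 * E :=
    weightedSum_le hE0 fun i hi => hle i (by omega)
  have t3' := mul_le_mul_of_nonneg_left t3 (Nat.cast_nonneg (α := ℝ) h)
  have t4' := mul_le_mul_of_nonneg_left t4 hμ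
  rw [lyap]
  linarith

end Lyapunov

/-- Exponential decay of the sequences that satisfy the Lyapunov estimate in every window. -/
theorem exists_exponential_decay {n h : ℕ} {c : ℝ} (hc : 0 < c)
    {P S R₁ R₂ S₁ S₂ : Matrix (Fin n) (Fin n) ℝ}
    (hP : P.PosDef) (hS : S.PosSemidef) (hR₁ : R₁.PosSemidef) (hR₂ : R₂.PosSemidef)
    (hRC₁ : (Matrix.fromBlocks R₁ S₁ S₁ᵀ R₁).PosSemidef)
    (hRC₂ : (Matrix.fromBlocks R₂ S₂ S₂ᵀ R₂).PosSemidef) :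
    ∃ C r : ℝ, 0 ≤ C ∧ 0 < r ∧ r < 1 ∧ ∀ g : ℕ → Fin n → ℝ,
      (∀ j, ∃ d₁ d₂, d₁ ≤ h ∧ d₂ ≤ h ∧
        c * (g (j + h) ⬝ᵥ g (j + h)) ≤ g (j + h) ⬝ᵥ (P *ᵥ g (j + h))
          - g (j + h + 1) ⬝ᵥ (P *ᵥ g (j + h + 1)) - g (j + h) ⬝ᵥ (S *ᵥ g (j + h))
          + g j ⬝ᵥ (S *ᵥ g j)
          - (h : ℝ) ^ 2 * ((g (j + h + 1) - g (j + h)) ⬝ᵥ (R₁ *ᵥ (g (j + h + 1) - g (j + h)))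
            + (g (j + h + 1) - g (j + h)) ⬝ᵥ (R₂ *ᵥ (g (j + h + 1) - g (j + h))))
          + recipForm R₁ S₁ (g (j + h) - g (j + d₁)) (g (j + d₁) - g j)
          + recipForm R₂ S₂ (g (j + h) - g (j + d₂)) (g (j + d₂) - g j)) →
      ∀ b : ℝ, 0 ≤ b → (∀ i ≤ h, euclNorm (g i) ≤ b) →
        ∀ j, euclNorm (g (j + h)) ≤ C * r ^ j * b := by
  obtain ⟨p, hp, hPp⟩ := exists_pos_mul_le_quadForm hP
  -- The shift of the μ-term adds μh|g(j+h)|²; with c = μ(h+1) a surplus μ|g(j+h)|² of the decrease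
  -- is left, matching the −μ|g(i)|² gained at the older samples.
  set μ := c / (h + 1) with hμdef
  have hμ : 0 < μ := by positivity
  have hμc : μ * (h + 1) = c := by rw [hμdef]; field_simp
  obtain ⟨C, hC, hup⟩ := exists_lyap_le h P S (R₁ + R₂) hμ.le
  have hρ0 : 0 < C / (C + μ) := by positivity
  have hρ1 : C / (C + μ) < 1 := by rw [div_lt_one (by positivity)]; linarith
  set ρ := C / (C + μ) with hρ
  refine ⟨√(C * (h + 1) / p), √ρ, Real.sqrt_nonneg _, Real.sqrt_pos.mpr hρ0,
    by rwa [Real.sqrt_lt' one_pos, one_pow], ?_⟩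
  intro g hg b hb hgb j
  have hdecr : ∀ j, lyap h P S (R₁ + R₂) μ (fun i => g (j + 1 + i)) ≤
      ρ * lyap h P S (R₁ + R₂) μ (fun i => g (j + i)) := by
    intro j
    obtain ⟨d₁, d₂, hd₁, hd₂, hj⟩ := hg j
    have i1 := recipForm_le_sum hR₁ hRC₁ (fun i => g (j + i)) d₁ (h - d₁)
    have i2 := recipForm_le_sum hR₂ hRC₂ (fun i => g (j + i)) d₂ (h - d₂)
    have hsh := lyap_shift h P S (R₁ + R₂) μ (fun i => g (j + i))
    have hupj := hup (fun i => g (j + i))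
    rw [Nat.add_sub_of_le hd₁] at i1
    rw [Nat.add_sub_of_le hd₂] at i2
    simp only [Finset.sum_range_succ] at hupj
    have e : (fun i => g (j + 1 + i)) = fun i => g (j + (i + 1)) := by
      funext i
      congr 1
      ring
    rw [e]
    simp only [← add_assoc, add_zero, Matrix.add_mulVec, dotProduct_add,
      Finset.sum_add_distrib] at i1 i2 hsh hupj ⊢
    set V := lyap h P S (R₁ + R₂) μ (fun i => g (j + i))
    set V' := lyap h P S (R₁ + R₂) μ (fun i => g (j + i + 1))
    set E := ∑ i ∈ Finset.range h, g (j + i) ⬝ᵥ g (j + i)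
    have hdec : V' ≤ V - μ * (E + g (j + h) ⬝ᵥ g (j + h)) := by
      rw [← hμc] at hj
      rw [hsh]
      linarith
    have : μ * V ≤ C * (V - V') :=
      calc μ * V ≤ μ * (C * (E + g (j + h) ⬝ᵥ g (j + h))) := by gcongr
        _ = C * (μ * (E + g (j + h) ⬝ᵥ g (j + h))) := by ring
        _ ≤ C * (V - V') := by gcongr; linarith
    -- The rate C/(C+μ) lies in (0,1) without comparing C and μ; the price is the monotonicity V' ≤
    -- V.
    rw [hρ, div_mul_eq_mul_div, le_div_iff₀ (by positivity)]
    have hE : 0 ≤ E := Finset.sum_nonneg fun i _ => dotProduct_self_nonneg' _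
    have hV : V' ≤ V :=
      hdec.trans (sub_le_self _ (mul_nonneg hμ.le (add_nonneg hE (dotProduct_self_nonneg' _))))
    linarith [mul_le_mul_of_nonneg_left hV hμ.le]
  have hpow : ∀ j, lyap h P S (R₁ + R₂) μ (fun i => g (j + i)) ≤
      ρ ^ j * lyap h P S (R₁ + R₂) μ (fun i => g (0 + i)) := by
    intro j
    induction j with
    | zero => simp
    | succ j ih =>
      calc _ ≤ ρ * lyap h P S (R₁ + R₂) μ (fun i => g (j + i)) := hdecr j
        _ ≤ ρ * (ρ ^ j * lyap h P S (R₁ + R₂) μ (fun i => g (0 + i))) := by gcongr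
        _ = _ := by ring
  have hinit : lyap h P S (R₁ + R₂) μ (fun i => g (0 + i)) ≤ C * ((h + 1) * b ^ 2) := by
    refine (hup _).trans (mul_le_mul_of_nonneg_left ?_ hC.le)
    calc _ ≤ ∑ _i ∈ Finset.range (h + 1), b ^ 2 := by
          refine Finset.sum_le_sum fun i hi => ?_
          rw [← euclNorm_sq, zero_add]
          exact pow_le_pow_left₀ (euclNorm_nonneg _)
            (hgb i (Nat.lt_succ_iff.mp (Finset.mem_range.mp hi))) 2
      _ = _ := by simp
  have hfin : p * euclNorm (g (j + h)) ^ 2 ≤ ρ ^ j * (C * ((h + 1) * b ^ 2)) := by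
    rw [euclNorm_sq]
    calc _ ≤ _ := hPp _
      _ ≤ _ := quadForm_le_lyap hS (hR₁.add hR₂) hμ.le (fun i => g (j + i))
      _ ≤ _ := hpow j
      _ ≤ _ := by gcongr
  refine le_of_sq_le_sq ?_ (by positivity)
  rw [mul_pow, mul_pow, ← pow_mul, mul_comm j 2, pow_mul, Real.sq_sqrt (by positivity),
    Real.sq_sqrt hρ0.le]
  rw [← mul_le_mul_iff_right₀ hp]
  calc _ ≤ _ := hfin
    _ = _ := by field_simp

/-! ### Growth over finitely many steps -/

theorem euclNorm_le_histNorm {n hbar : ℕ} (z : ℤ → Fin n → ℝ) {j : ℤ} (hj : -(hbar : ℤ) ≤ j)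
    (hj0 : j ≤ 0) : euclNorm (z j) ≤ histNorm hbar z := by
  obtain ⟨i, rfl⟩ : ∃ i : ℕ, j = -(i : ℤ) := ⟨(-j).toNat, by omega⟩
  exact Finset.le_sup' (fun i : ℕ => euclNorm (z (-(i : ℤ)))) (Finset.mem_range.mpr (by omega))

theorem exists_growth_bound {n m : ℕ} (A₀ A₁ : Matrix (Fin n) (Fin n) ℝ)
    (B : Matrix (Fin n) (Fin m) ℝ) (K : Matrix (Fin m) (Fin n) ℝ) (hbar : ℕ) :
    ∃ L : ℝ, 1 ≤ L ∧ ∀ η₁ η₂ : ℕ → ℕ, (∀ k, η₁ k ≤ hbar) → (∀ k, η₂ k ≤ hbar) →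
      ∀ (x : ℤ → Fin n → ℝ) (u : ℤ → Fin m → ℝ), IsClosedLoopSolution A₀ A₁ B K η₁ η₂ x u →
        ∀ (k : ℕ) (j : ℤ), -(hbar : ℤ) ≤ j → j ≤ k →
          euclNorm (x j) ≤ L ^ k * max (histNorm hbar x) (histNorm hbar u) := by
  have a0 := specNorm_nonneg A₀
  have a1 := specNorm_nonneg A₁
  have b0 := specNorm_nonneg B
  have k0 := specNorm_nonneg K
  -- The factor 1 + ‖K‖ bounds a delayed input in both cases: initial data or feedback.
  refine ⟨1 + specNorm A₀ + specNorm A₁ + specNorm B * (1 + specNorm K),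
    by nlinarith [mul_nonneg b0 k0], ?_⟩
  set L := 1 + specNorm A₀ + specNorm A₁ + specNorm B * (1 + specNorm K) with hL
  have hL1 : 1 ≤ L := by nlinarith [mul_nonneg b0 k0]
  intro η₁ η₂ hη₁ hη₂ x u ⟨hx, hu⟩
  set D := max (histNorm hbar x) (histNorm hbar u)
  have hD : 0 ≤ D := (euclNorm_nonneg _).trans
    ((euclNorm_le_histNorm x (j := 0) (by omega) le_rfl).trans (le_max_left _ _))
  intro k
  induction k with
  | zero =>
    intro j hj hj0
    rw [pow_zero, one_mul]
    exact (euclNorm_le_histNorm x hj (by simpa using hj0)).trans (le_max_left _ _)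
  | succ k ih =>
    intro j hj hjk
    have hLk : 0 ≤ L ^ k * D := by positivity
    rcases hjk.lt_or_eq with hlt | rfl
    · refine (ih j hj (by push_cast at hlt; omega)).trans ?_
      rw [pow_succ, mul_right_comm]
      exact le_mul_of_one_le_right hLk hL1
    · push_cast
      have e1 := hη₁ k
      have e2 := hη₂ k
      have x0 := ih k (by omega) le_rfl
      have x1 := ih (k - η₁ k) (by omega) (by omega)
      have u2 : euclNorm (u (k - η₂ k)) ≤ (1 + specNorm K) * (L ^ k * D) := by
        rcases le_or_gt ((k : ℤ) - η₂ k) 0 with h0 | h0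
        · calc _ ≤ D := (euclNorm_le_histNorm u (by omega) h0).trans (le_max_right _ _)
            _ ≤ L ^ k * D := le_mul_of_one_le_left hD (one_le_pow₀ hL1)
            _ ≤ _ := le_mul_of_one_le_left hLk (by linarith)
        · rw [hu _ h0]
          calc _ ≤ specNorm K * (L ^ k * D) := (euclNorm_mulVec_le _ _).trans
                (mul_le_mul_of_nonneg_left (ih _ (by omega) (by omega)) k0)
            _ ≤ _ := by gcongr; linarith
      rw [hx k]
      calc _ ≤ specNorm A₀ * (L ^ k * D) + specNorm A₁ * (L ^ k * D)
            + specNorm B * ((1 + specNorm K) * (L ^ k * D)) := by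
            refine (euclNorm_add_le _ _).trans (add_le_add ((euclNorm_add_le _ _).trans
              (add_le_add ?_ ?_)) ?_)
            · exact (euclNorm_mulVec_le _ _).trans (mul_le_mul_of_nonneg_left x0 a0)
            · exact (euclNorm_mulVec_le _ _).trans (mul_le_mul_of_nonneg_left x1 a1)
            · exact (euclNorm_mulVec_le _ _).trans (mul_le_mul_of_nonneg_left u2 b0)
        _ ≤ L * (L ^ k * D) := by rw [hL]; linarith
        _ = _ := by ring

end

end DelayControl

/-! ### Invertibility of X₀Q₃ and stability of the closed loop -/

theorem theorem2 {n m T hbar h₁ h₂ : ℕ}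
    (hbar_pos : 0 < hbar) (hT : hbar < T) (hh₁ : h₁ ≤ hbar) (hh₂ : h₂ ≤ hbar)
    (A₀ A₁ : Matrix (Fin n) (Fin n) ℝ) (B : Matrix (Fin n) (Fin m) ℝ)
    -- recorded data `x`, `u`: a nominal trajectory plus noise
    (x xnom xδ : ℤ → Fin n → ℝ) (u unom uδ : ℤ → Fin m → ℝ)
    (hx : ∀ k : ℤ, -(hbar : ℤ) ≤ k → k ≤ T → x k = xnom k + xδ k)
    (hu : ∀ k : ℤ, -(hbar : ℤ) ≤ k → k ≤ T → u k = unom k + uδ k)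
    (hnom : DelayControl.IsTrajectoryOn A₀ A₁ B h₁ h₂ T xnom unom)
    (hrank : (DelayControl.dataW u x h₁ h₂ T).rank = m + 2 * n)
    -- bound on the mismatch
    (α : ℝ) (hα : 0 < α)
    (hΔ : DelayControl.specNorm (DelayControl.mismatch A₀ A₁ B h₁ h₂ T xδ uδ) ≤ α)
    -- feasibility of the matrix inequalities and equality constraints
    (ε : ℝ) (hε : 0 < ε)
    (P S R₁ R₂ S₁ S₂ : Matrix (Fin n) (Fin n) ℝ) (Q₁ Q₂ Q₃ : Matrix (Fin T) (Fin n) ℝ) (lam : ℝ)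
    (hP : P.PosDef) (hS : S.PosDef) (hR₁ : R₁.PosDef) (hR₂ : R₂.PosDef) (hlam : 0 < lam)
    (hLMI : (DelayControl.augmented α lam
      (DelayControl.Phi hbar ε (DelayControl.dataMat x 0 T) (DelayControl.dataMat x 1 T)
        P S R₁ R₂ S₁ S₂ Q₁ Q₂ Q₃)
      (DelayControl.bigQ ε Q₁ Q₂ Q₃)).PosDef)
    (hRC₁ : (Matrix.fromBlocks R₁ S₁ S₁ᵀ R₁).PosSemidef)
    (hRC₂ : (Matrix.fromBlocks R₂ S₂ S₂ᵀ R₂).PosSemidef)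
    (hUQ₂ : DelayControl.dataMat (DelayControl.delayed u h₂) 0 T * Q₂ = 0)
    (hUQ₃ : DelayControl.dataMat (DelayControl.delayed u h₂) 0 T * Q₃ = 0)
    (hXhQ₁ : DelayControl.dataMat (DelayControl.delayed x h₁) 0 T * Q₁ = 0)
    (hXhQ₃ : DelayControl.dataMat (DelayControl.delayed x h₁) 0 T * Q₃ = 0)
    (hXQ₁ : DelayControl.dataMat x 0 T * Q₁ = 0)
    (hXQ₂ : DelayControl.dataMat x 0 T * Q₂ = 0)
    (hXhQ₂ : DelayControl.dataMat (DelayControl.delayed x h₁) 0 T * Q₂ =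
      DelayControl.dataMat x 0 T * Q₃)
    -- the feedback gain
    (K : Matrix (Fin m) (Fin n) ℝ)
    (hK : K = DelayControl.dataMat (DelayControl.delayed u h₂) 0 T * Q₁ *
      (DelayControl.dataMat x 0 T * Q₃)⁻¹) :
    IsUnit (DelayControl.dataMat x 0 T * Q₃) ∧ DelayControl.ExpStable A₀ A₁ B K hbar := by
  open DelayControl in
  have hdata := dataMat_one_eq hh₁ hh₂ hx hu hnom
  obtain ⟨c, hc, hcoer⟩ := exists_pos_mul_le_quadForm hLMI
  set X₀ := dataMat x 0 T
  set X₁ := dataMat x 1 T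
  set F := X₀ * Q₃ with hF
  set D := mismatch A₀ A₁ B h₁ h₂ T xδ uδ
  have e3 : X₁ * Q₃ = A₀ * F - D * Q₃ := by
    rw [hdata, Matrix.sub_mul, sysMat_mul_dataW_mul, hUQ₃, hXhQ₃]
    simp [hF, X₀]
  have e2 : X₁ * Q₂ = A₁ * F - D * Q₂ := by
    rw [hdata, Matrix.sub_mul, sysMat_mul_dataW_mul, hUQ₂, hXhQ₂, hXQ₂]
    simp
  have hunit : IsUnit F := by
    rw [← Matrix.mulVec_injective_iff_isUnit, ← Matrix.coe_mulVecLin]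
    refine (injective_iff_map_eq_zero _).mpr fun y hy => ?_
    rw [Matrix.mulVecLin_apply] at hy
    -- Before invertibility K is not usable, so N₁ is chosen to make its identity trivial; it only
    -- multiplies z₂ = 0.
    have hest := lmi_estimate (N₁ := X₁ * Q₁ + D * Q₁) hR₁.isHermitian hR₂.isHermitian hlam hΔ
      (by abel) e2 e3 hc hcoer 0 0 0 0 y (by rw [← hF, hy]; simp)
    simp only [recipForm, Matrix.mulVec_zero, dotProduct_zero, sub_zero, mul_zero,
      add_zero, zero_sub] at hest
    have r1 := dotProduct_mulVec_nonneg_of_posSemidef hR₁.posSemidef y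
    have r2 := dotProduct_mulVec_nonneg_of_posSemidef hR₂.posSemidef y
    have hh := mul_nonneg (sq_nonneg (hbar : ℝ)) (add_nonneg r1 r2)
    by_contra hy0
    have := hP.dotProduct_mulVec_pos hy0
    rw [star_trivial] at this
    linarith
  refine ⟨hunit, ?_⟩
  have hdet : IsUnit F.det := (Matrix.isUnit_iff_isUnit_det F).mp hunit
  have e1 : X₁ * Q₁ = B * K * F - D * Q₁ := by
    rw [hdata, Matrix.sub_mul, sysMat_mul_dataW_mul, hXhQ₁, hXQ₁, hK, Matrix.mul_assoc B,
      Matrix.nonsing_inv_mul_cancel_right _ _ hdet]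
    simp
  obtain ⟨C, r, hC, hr0, hr1, hdecay⟩ := exists_exponential_decay (h := hbar) hc hP hS.posSemidef
    hR₁.posSemidef hR₂.posSemidef hRC₁ hRC₂
  obtain ⟨L, hL1, hgrow⟩ := exists_growth_bound A₀ A₁ B K hbar
  have f0 := specNorm_nonneg F
  have fi0 := specNorm_nonneg F⁻¹
  -- The factor (L/r)^(h̄+1) pays for the growth up to time h̄+1 and for the decay counted from
  -- there; the summand 1 covers k ≤ h̄.
  refine ⟨(specNorm F * C * specNorm F⁻¹ + 1) * (L / r) ^ (hbar + 1), r, by positivity, hr0, hr1,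
    fun η₁ η₂ hη₁ hη₂ x u hsol k => ?_⟩
  have hg := hgrow η₁ η₂ hη₁ hη₂ x u hsol
  set M := max (histNorm hbar x) (histNorm hbar u)
  have hM : 0 ≤ M := (euclNorm_nonneg _).trans
    ((euclNorm_le_histNorm x (j := 0) (by omega) le_rfl).trans (le_max_left _ _))
  have hL0 : 0 < L := by linarith
  have hq : 0 ≤ specNorm F * C * specNorm F⁻¹ := by positivity
  rcases lt_or_ge k (hbar + 1) with hk | hk
  · calc _ ≤ L ^ (hbar + 1) * M := hg (hbar + 1) k (by omega) (by push_cast; omega)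
      _ = 1 * (L / r) ^ (hbar + 1) * r ^ (hbar + 1) * M := by
        rw [div_pow]
        field_simp
      _ ≤ _ := by
        gcongr ?_ * _ * ?_ * _
        · linarith
        · exact pow_le_pow_of_le_one hr0.le hr1.le hk.le
  · obtain ⟨j, rfl⟩ := Nat.exists_eq_add_of_le hk
    have hFF (v : Fin n → ℝ) : F *ᵥ (F⁻¹ *ᵥ v) = v := by
      rw [Matrix.mulVec_mulVec, Matrix.mul_nonsing_inv _ hdet, Matrix.one_mulVec]
    -- The window starts at time 1: at times k ≥ h̄+1 every delayed input has positive time and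
    -- equals Kx.
    have hres := hdecay (fun i => F⁻¹ *ᵥ x ((1 + i : ℕ) : ℤ)) (fun j => by
      have hη₁' := hη₁ (1 + (j + hbar))
      have hη₂' := hη₂ (1 + (j + hbar))
      -- Windows are indexed from their oldest sample, so delay η sits at position h̄ − η.
      refine ⟨hbar - η₁ (1 + (j + hbar)), hbar - η₂ (1 + (j + hbar)), Nat.sub_le _ _,
        Nat.sub_le _ _, lmi_estimate hR₁.isHermitian hR₂.isHermitian hlam hΔ e1 e2 e3 hc hcoer
        _ _ _ _ _ ?_⟩
      simp only [← hF, ← Matrix.mulVec_mulVec, hFF]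
      have hs := hsol.1 (1 + (j + hbar))
      rw [hsol.2 _ (by push_cast; omega)] at hs
      have t1 : ((1 + (j + (hbar - η₁ (1 + (j + hbar)))) : ℕ) : ℤ) =
          ((1 + (j + hbar) : ℕ) : ℤ) - η₁ (1 + (j + hbar)) := by omega
      have t2 : ((1 + (j + (hbar - η₂ (1 + (j + hbar)))) : ℕ) : ℤ) =
          ((1 + (j + hbar) : ℕ) : ℤ) - η₂ (1 + (j + hbar)) := by omega
      rw [t1, t2, ← hs]
      congr 1)
      (specNorm F⁻¹ * (L ^ (hbar + 1) * M)) (by positivity)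
      (fun i hi => (euclNorm_mulVec_le _ _).trans (mul_le_mul_of_nonneg_left
        (hg (hbar + 1) _ (by omega) (by push_cast; omega)) fi0)) j
    have hidx : (hbar + 1 + j : ℕ) = 1 + (j + hbar) := by ring
    rw [hidx, ← hFF (x ((1 + (j + hbar) : ℕ) : ℤ))]
    calc _ ≤ specNorm F * (C * r ^ j * (specNorm F⁻¹ * (L ^ (hbar + 1) * M))) :=
          (euclNorm_mulVec_le _ _).trans (mul_le_mul_of_nonneg_left hres f0)
      _ = specNorm F * C * specNorm F⁻¹ * (L / r) ^ (hbar + 1) * r ^ (1 + (j + hbar)) * M := by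
        rw [div_pow, ← hidx, pow_add r (hbar + 1) j]
        field_simp
      _ ≤ _ := by
        gcongr
        linarith
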